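/- Let $J,R,Q\in\mathbb R^{n\times n}$, $B,P\in\mathbb R^{n\times m}$ and $D\in\mathbb R^{m\times m}$ satisfy $J=-J^\top$, $R=R^\top\ge 0$, $Q=Q^\top\ge 0$, $S:=\tfrac12(D+D^\top)\ge 0$ and $$W:=\begin{pmatrix}QRQ & QP\\ P^\top Q & S\end{pmatrix}\ge 0 .$$ Let $\mathbb U\subset\mathbb R^m$ be convex and compact with $0\in\operatorname{int}\mathbb U$, and let $\Phi\subset\mathbb R^n$ be closed. For $T>0$ and $x^0\in\mathbb R^n$ consider the optimal control problem $$\min_{u\in L^1(0,T;\mathbb U)}\int_0^T u(t)^\top y(t)\,dt\quad\text{s.t.}\quad \dot x=(J-R)Qx+(B-P)u,\quad y=(B+P)^\top Qx+Du,\quad x(0)=x^0,\quad x(T)\in\Phi. \qquad(\ast)$$ For $z\in\mathbb R^n$ let $\mathcal C(z)$ be the set of all states that can be steered to $z$ at some time $t\ge 0$ by a control in $L^1(0,t;\mathbb U)$ under $\dot x=(J-R)Qx+(B-P)u$ (for $t=0$ this is the state $z$ only), and let $\mathcal C(\Phi):=\bigcup_{z\in\Phi}\mathcal C(z)$. A steady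 state is a pair $(\bar x,\bar u)\in\mathbb R^n\times\mathbb U$ with $(J-R)Q\bar x+(B-P)\bar u=0$; it is called optimal if it minimizes $\bar u^\top\big((B+P)^\top Q\bar x+D\bar u\big)$ among all steady states. Let $(\bar x_e,\bar u_e)$ be an optimal steady state with $\bar u_e\in\operatorname{int}\mathbb U$ and $\bar x_e\in\mathcal C(\Phi)$. Then the problem $(\ast)$ has the input-state integral turnpike property on $\mathcal C(\bar x_e)$ with respect to $\ker W$; that is, $\mathcal C(\bar x_e)\subset\mathcal C(\Phi)$ and there exist continuous functions $F,\tau:\mathcal C(\bar x_e)\to[0,\infty)$ such that for all $x^0\in\mathcal C(\bar x_e)$ and all $T>\tau(x^0)$ every optimal pair $(x^\star,u^\star)$ of $(\ast)$ with horizon $T$ and $x^\star(0)=x^0$ satisfies $$\int_0^T\operatorname{dist}^2\big((x^\star(t),u^\star(t)),\ker W\big)\,dt\le F(x^0),$$ where $\operatorname{dist}$ is the Euclidean distance in $\mathbb R^n\times\mathbb R^m$. -/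

import Mathlib

open MeasureTheory Set
open scoped Matrix NNReal

/-- The pair `(x, u)` as a vector of `ℝⁿ × ℝᵐ` with its Euclidean norm. -/
noncomputable def stack {n m : ℕ} (x : EuclideanSpace ℝ (Fin n)) (u : EuclideanSpace ℝ (Fin m)) :
    EuclideanSpace ℝ (Fin n ⊕ Fin m) :=
  WithLp.toLp 2 (Sum.elim (fun i => x i) (fun j => u j))

/-- `u ∈ L¹(0,T;𝕌)`, for a representative `u` defined on all of `ℝ`. -/
structure IsControl {m : ℕ} (U : Set (EuclideanSpace ℝ (Fin m))) (T : ℝ)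
    (u : ℝ → EuclideanSpace ℝ (Fin m)) : Prop where
  integrable : IntegrableOn u (Icc 0 T)
  mem : ∀ᵐ t ∂(volume.restrict (Icc 0 T)), u t ∈ U

/-- `x` is on `[0,T]` the (Carathéodory) solution of `ẋ = A x + B u`, `x(0) = x⁰`: it is continuous
and satisfies the integrated equation. -/
structure IsTrajectory {n m : ℕ} (A : Matrix (Fin n) (Fin n) ℝ) (B : Matrix (Fin n) (Fin m) ℝ)
    (T : ℝ) (x0 : EuclideanSpace ℝ (Fin n))
    (x : ℝ → EuclideanSpace ℝ (Fin n)) (u : ℝ → EuclideanSpace ℝ (Fin m)) : Prop where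
  cont : ContinuousOn x (Icc 0 T)
  eq : ∀ t ∈ Icc 0 T,
    x t = x0 + ∫ s in (0 : ℝ)..t, (A.toEuclideanLin (x s) + B.toEuclideanLin (u s))

/-- `𝒞_t(z)`: the states that can be steered to `z` at time `t` by a control with values in `U`. -/
def controllableSetAt {n m : ℕ} (A : Matrix (Fin n) (Fin n) ℝ) (B : Matrix (Fin n) (Fin m) ℝ)
    (U : Set (EuclideanSpace ℝ (Fin m))) (t : ℝ) (z : EuclideanSpace ℝ (Fin n)) :
    Set (EuclideanSpace ℝ (Fin n)) :=
  {x0 | ∃ x u, IsControl U t u ∧ IsTrajectory A B t x0 x u ∧ x t = z}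

/-- The above definition gives the convention `𝒞_0(z) = {z}`. -/
theorem controllableSetAt_zero {n m : ℕ} (A : Matrix (Fin n) (Fin n) ℝ)
    (B : Matrix (Fin n) (Fin m) ℝ) (U : Set (EuclideanSpace ℝ (Fin m)))
    (z : EuclideanSpace ℝ (Fin n)) : controllableSetAt A B U 0 z = {z} := by
  ext x0
  simp only [controllableSetAt, mem_ofPred_eq, mem_singleton_iff]
  constructor
  · rintro ⟨x, u, -, hx, rfl⟩
    simpa using (hx.eq 0 (by simp)).symm
  · rintro rfl
    refine ⟨fun _ => x0, fun _ => 0, ⟨?_, ?_⟩, ⟨continuousOn_const, ?_⟩, rfl⟩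
    · simp
    · simp
    · intro t ht
      obtain rfl : t = 0 := by simpa using ht
      simp

/-- `𝒞(Φ)`: the states that can be steered into the set `Φ` at some time `t ≥ 0`. -/
def controllableSet {n m : ℕ} (A : Matrix (Fin n) (Fin n) ℝ) (B : Matrix (Fin n) (Fin m) ℝ)
    (U : Set (EuclideanSpace ℝ (Fin m))) (Φ : Set (EuclideanSpace ℝ (Fin n))) :
    Set (EuclideanSpace ℝ (Fin n)) :=
  ⋃ z ∈ Φ, ⋃ t ∈ Ici (0 : ℝ), controllableSetAt A B U t z

/-- The data of the family (in `T` and `x⁰`) of optimal control problems with linear dynamics: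
minimize `φ(x(T)) + ∫₀ᵀ ℓ(x(t),u(t)) dt` over `u ∈ L¹(0,T;𝕌)` subject to `ẋ = A x + B u`,
`x(0) = x⁰`, `x(T) ∈ Φ`. -/
structure LinearOCP (n m : ℕ) where
  A : Matrix (Fin n) (Fin n) ℝ
  B : Matrix (Fin n) (Fin m) ℝ
  U : Set (EuclideanSpace ℝ (Fin m))
  Φ : Set (EuclideanSpace ℝ (Fin n))
  φ : EuclideanSpace ℝ (Fin n) → ℝ
  ℓ : EuclideanSpace ℝ (Fin n) → EuclideanSpace ℝ (Fin m) → ℝ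

/-- The cost `φ(x(T)) + ∫₀ᵀ ℓ(x(t),u(t)) dt`. -/
noncomputable def LinearOCP.cost {n m : ℕ} (p : LinearOCP n m) (T : ℝ)
    (x : ℝ → EuclideanSpace ℝ (Fin n)) (u : ℝ → EuclideanSpace ℝ (Fin m)) : ℝ :=
  p.φ (x T) + ∫ t in (0 : ℝ)..T, p.ℓ (x t) (u t)

/-- `(x, u)` satisfies the constraints of the problem with horizon `T` and initial datum `x⁰`. -/
structure LinearOCP.IsAdmissible {n m : ℕ} (p : LinearOCP n m) (T : ℝ)
    (x0 : EuclideanSpace ℝ (Fin n))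
    (x : ℝ → EuclideanSpace ℝ (Fin n)) (u : ℝ → EuclideanSpace ℝ (Fin m)) : Prop where
  control : IsControl p.U T u
  trajectory : IsTrajectory p.A p.B T x0 x u
  target : x T ∈ p.Φ

/-- `(x, u)` is an optimal pair of the problem with horizon `T` and initial datum `x⁰`. -/
structure LinearOCP.IsOptimalPair {n m : ℕ} (p : LinearOCP n m) (T : ℝ)
    (x0 : EuclideanSpace ℝ (Fin n))
    (x : ℝ → EuclideanSpace ℝ (Fin n)) (u : ℝ → EuclideanSpace ℝ (Fin m)) : Prop where
  admissible : p.IsAdmissible T x0 x u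
  optimal : ∀ x' u', p.IsAdmissible T x0 x' u' → p.cost T x u ≤ p.cost T x' u'

/-- The input-state integral turnpike property on `Stp ⊆ 𝒞(Φ)` with respect to the subspace `V`. -/
def LinearOCP.HasInputStateIntegralTurnpike {n m : ℕ} (p : LinearOCP n m)
    (Stp : Set (EuclideanSpace ℝ (Fin n)))
    (V : Submodule ℝ (EuclideanSpace ℝ (Fin n ⊕ Fin m))) : Prop :=
  Stp ⊆ controllableSet p.A p.B p.U p.Φ ∧
  ∃ F τ : Stp → ℝ≥0, Continuous F ∧ Continuous τ ∧
    ∀ (x0 : Stp) (T : ℝ), (τ x0 : ℝ) < T →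
      ∀ x u, p.IsOptimalPair T x0 x u →
        IntervalIntegrable (fun t => Metric.infDist (stack (x t) (u t)) V ^ 2) volume 0 T ∧
        ∫ t in (0 : ℝ)..T, Metric.infDist (stack (x t) (u t)) V ^ 2 ≤ F x0

/-- `S = (D + Dᵀ) / 2`. -/
noncomputable def symPart {m : ℕ} (D : Matrix (Fin m) (Fin m) ℝ) : Matrix (Fin m) (Fin m) ℝ :=
  (1 / 2 : ℝ) • (D + Dᵀ)

/-- `W = [[Q R Q, Q P], [Pᵀ Q, S]]`. -/
noncomputable def dissipationMatrix {n m : ℕ} (R Q : Matrix (Fin n) (Fin n) ℝ)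
    (P : Matrix (Fin n) (Fin m) ℝ) (D : Matrix (Fin m) (Fin m) ℝ) :
    Matrix (Fin n ⊕ Fin m) (Fin n ⊕ Fin m) ℝ :=
  Matrix.fromBlocks (Q * R * Q) (Q * P) (Pᵀ * Q) (symPart D)

/-- The output `y = (B + P)ᵀ Q x + D u`. -/
noncomputable def phOutput {n m : ℕ} (Q : Matrix (Fin n) (Fin n) ℝ)
    (B P : Matrix (Fin n) (Fin m) ℝ) (D : Matrix (Fin m) (Fin m) ℝ)
    (x : EuclideanSpace ℝ (Fin n)) (u : EuclideanSpace ℝ (Fin m)) : EuclideanSpace ℝ (Fin m) :=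
  ((B + P)ᵀ * Q).toEuclideanLin x + D.toEuclideanLin u

/-- The supply rate `uᵀ y`. -/
noncomputable def supplyRate {n m : ℕ} (Q : Matrix (Fin n) (Fin n) ℝ)
    (B P : Matrix (Fin n) (Fin m) ℝ) (D : Matrix (Fin m) (Fin m) ℝ)
    (x : EuclideanSpace ℝ (Fin n)) (u : EuclideanSpace ℝ (Fin m)) : ℝ :=
  inner ℝ u (phOutput Q B P D x u)

/-- The minimal energy supply problem for `ẋ = (J - R) Q x + (B - P) u`. -/
noncomputable def phOCP {n m : ℕ} (J R Q : Matrix (Fin n) (Fin n) ℝ)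
    (B P : Matrix (Fin n) (Fin m) ℝ) (D : Matrix (Fin m) (Fin m) ℝ)
    (U : Set (EuclideanSpace ℝ (Fin m))) (Φ : Set (EuclideanSpace ℝ (Fin n))) :
    LinearOCP n m where
  A := (J - R) * Q
  B := B - P
  U := U
  Φ := Φ
  φ := fun _ => 0
  ℓ := supplyRate Q B P D

/-- `(x, u) ∈ ℝⁿ × 𝕌` is a steady state: `(J - R) Q x + (B - P) u = 0`. -/
structure IsSteadyState {n m : ℕ} (J R Q : Matrix (Fin n) (Fin n) ℝ)
    (B P : Matrix (Fin n) (Fin m) ℝ) (U : Set (EuclideanSpace ℝ (Fin m)))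
    (x : EuclideanSpace ℝ (Fin n)) (u : EuclideanSpace ℝ (Fin m)) : Prop where
  mem : u ∈ U
  eq : ((J - R) * Q).toEuclideanLin x + (B - P).toEuclideanLin u = 0

/-- The steady state `(x, u)` minimizes `uᵀ y` among all steady states. -/
structure IsOptimalSteadyState {n m : ℕ} (J R Q : Matrix (Fin n) (Fin n) ℝ)
    (B P : Matrix (Fin n) (Fin m) ℝ) (D : Matrix (Fin m) (Fin m) ℝ)
    (U : Set (EuclideanSpace ℝ (Fin m)))
    (x : EuclideanSpace ℝ (Fin n)) (u : EuclideanSpace ℝ (Fin m)) : Prop where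
  steady : IsSteadyState J R Q B P U x u
  optimal : ∀ x' u', IsSteadyState J R Q B P U x' u' →
    supplyRate Q B P D x u ≤ supplyRate Q B P D x' u'

/-! The proof compares the optimal pair with one explicit competitor through the power balance.
Write `H(x) = xᵀQx / 2`. Since `J` is skew, the energy supplied along any trajectory equals the gain
in `H` plus the integral of the quadratic form of `W` (`supplyRate_eq`, `integral_supplyRate_eq`).
As `H ≥ 0`, the dissipation of an optimal pair is at most `H(x⁰)` plus its cost, and the quadratic
form of `W` controls the squared distance to its kernel
(`Matrix.PosSemidef.exists_sq_infDist_ker_le`).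

The competitor goes from `x⁰` to the optimal steady state, rests there, and finally moves into `Φ`
along a fixed trajectory. Resting costs nothing, because `(0, 0)` is a steady state of zero supply,
so the optimal one has supply `≤ 0`. Hence the cost is bounded independently of the horizon.

The delicate point is continuity of the bound in `x⁰`, which needs a steering time depending
continuously on `x⁰` (`exists_continuous_mem_controllableSetAt`). By linearity, differences of
controllable states lie in a subspace of null-controllable states invariant under the free flow;
small elements of it are removed by small controls, admissible because the steady input is interior.
This gives locally constant times, which a partition of unity glues. -/

/-- The function equal to `f` up to time `s` and to `g`, restarted at time `s`, afterwards. -/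
noncomputable def glue {E : Type*} (s : ℝ) (f g : ℝ → E) (r : ℝ) : E :=
  if r ≤ s then f r else g (r - s)

/-! ### Concatenation of functions and their integrals. -/

section Glue

variable {E F G : Type*}

theorem glue_of_le {s r : ℝ} (f g : ℝ → E) (h : r ≤ s) : glue s f g r = f r := if_pos h

theorem glue_of_lt {s r : ℝ} (f g : ℝ → E) (h : s < r) : glue s f g r = g (r - s) :=
  if_neg (not_le.2 h)

theorem glue_add_of_eq {s t : ℝ} {f g : ℝ → E} (ht : 0 ≤ t) (h : g 0 = f s) :
    glue s f g (s + t) = g t := by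
  rcases ht.eq_or_lt with rfl | ht
  · rw [add_zero, glue_of_le _ _ le_rfl, h]
  · rw [glue_of_lt _ _ (by linarith), add_sub_cancel_left]

theorem map_glue (Φ : E → F → G) (s : ℝ) (f g : ℝ → E) (u v : ℝ → F) :
    (fun r => Φ (glue s f g r) (glue s u v r)) =
      glue s (fun r => Φ (f r) (u r)) (fun r => Φ (g r) (v r)) := by
  funext r
  unfold glue
  split_ifs <;> rfl

variable [NormedAddCommGroup E]

theorem intervalIntegrable_glue_left {s : ℝ} (hs : 0 ≤ s) {f : ℝ → E} (g : ℝ → E)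
    (hf : IntervalIntegrable f volume 0 s) : IntervalIntegrable (glue s f g) volume 0 s := by
  refine hf.congr ?_
  intro r hr
  rw [uIoc_of_le hs] at hr
  exact (glue_of_le f g hr.2).symm

theorem intervalIntegrable_glue_right {s t : ℝ} (ht : 0 ≤ t) (f : ℝ → E) {g : ℝ → E}
    (hg : IntervalIntegrable g volume 0 t) :
    IntervalIntegrable (glue s f g) volume s (s + t) := by
  have h := hg.comp_sub_right s
  rw [zero_add, add_comm t s] at h
  refine h.congr ?_
  intro r hr
  rw [uIoc_of_le (by linarith)] at hr
  exact (glue_of_lt f g hr.1).symm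

theorem intervalIntegrable_glue {s t : ℝ} (hs : 0 ≤ s) (ht : 0 ≤ t) {f g : ℝ → E}
    (hf : IntervalIntegrable f volume 0 s) (hg : IntervalIntegrable g volume 0 t) :
    IntervalIntegrable (glue s f g) volume 0 (s + t) :=
  (intervalIntegrable_glue_left hs g hf).trans (intervalIntegrable_glue_right ht f hg)

theorem integral_glue [NormedSpace ℝ E] {s t : ℝ} (hs : 0 ≤ s) (ht : 0 ≤ t) {f g : ℝ → E}
    (hf : IntervalIntegrable f volume 0 s) (hg : IntervalIntegrable g volume 0 t) :
    ∫ r in (0 : ℝ)..s + t, glue s f g r = (∫ r in (0 : ℝ)..s, f r) + ∫ r in (0 : ℝ)..t, g r := by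
  rw [← intervalIntegral.integral_add_adjacent_intervals (intervalIntegrable_glue_left hs g hf)
    (intervalIntegrable_glue_right ht f hg)]
  congr 1
  · refine intervalIntegral.integral_congr_uIoo fun r hr => ?_
    rw [uIoo_of_le hs] at hr
    exact glue_of_le f g hr.2.le
  · have : ∫ r in s..s + t, glue s f g r = ∫ r in s..s + t, g (r - s) := by
      refine intervalIntegral.integral_congr_uIoo fun r hr => ?_
      rw [uIoo_of_le (by linarith)] at hr
      exact glue_of_lt f g hr.1
    rw [this, intervalIntegral.integral_comp_sub_right]
    simp

end Glue

/-! ### Concatenation and superposition of trajectories; the free flow. -/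

section Trajectory

variable {n m : ℕ} {A : Matrix (Fin n) (Fin n) ℝ} {B : Matrix (Fin n) (Fin m) ℝ}
  {U V : Set (EuclideanSpace ℝ (Fin m))} {T s t : ℝ} {x0 y0 z : EuclideanSpace ℝ (Fin n)}
  {x y : ℝ → EuclideanSpace ℝ (Fin n)} {u v : ℝ → EuclideanSpace ℝ (Fin m)}

theorem IsControl.intervalIntegrable (hu : IsControl U T u) (hT : 0 ≤ T) :
    IntervalIntegrable u volume 0 T :=
  (intervalIntegrable_iff_integrableOn_Icc_of_le hT).2 hu.integrable

theorem isControl_of_intervalIntegrable (hT : 0 ≤ T) (hu : IntervalIntegrable u volume 0 T)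
    (hU : ∀ᵐ t, t ∈ Icc 0 T → u t ∈ U) : IsControl U T u :=
  ⟨(intervalIntegrable_iff_integrableOn_Icc_of_le hT).1 hu,
    (ae_restrict_iff' measurableSet_Icc).2 hU⟩

theorem IsControl.ae_mem (hu : IsControl U T u) : ∀ᵐ t, t ∈ Icc 0 T → u t ∈ U :=
  (ae_restrict_iff' measurableSet_Icc).1 hu.mem

theorem isControl_const {c : EuclideanSpace ℝ (Fin m)} (hc : c ∈ U) :
    IsControl U T (fun _ => c) :=
  ⟨by simp, by simp [hc]⟩

theorem IsControl.mono (hu : IsControl U T u) (h : U ⊆ V) : IsControl V T u :=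
  ⟨hu.integrable, hu.mem.mono fun _ ht => h ht⟩

theorem IsControl.glue (hs : 0 ≤ s) (ht : 0 ≤ t) (hu : IsControl U s u) (hv : IsControl U t v) :
    IsControl U (s + t) (glue s u v) := by
  refine isControl_of_intervalIntegrable (by linarith)
    (intervalIntegrable_glue hs ht (hu.intervalIntegrable hs) (hv.intervalIntegrable ht)) ?_
  have h1 := (measurePreserving_sub_right volume s).quasiMeasurePreserving.ae hv.ae_mem
  filter_upwards [hu.ae_mem, h1] with r hr hr' hmem
  rcases le_or_gt r s with h | h
  · rw [glue_of_le _ _ h]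
    exact hr ⟨hmem.1, h⟩
  · rw [glue_of_lt _ _ h]
    exact hr' ⟨by linarith, by linarith [hmem.2]⟩

theorem IsControl.linearCombination (hu : IsControl U T u) (hv : IsControl V T v) (a b : ℝ)
    {S : Set (EuclideanSpace ℝ (Fin m))} (hS : ∀ p ∈ U, ∀ q ∈ V, a • p + b • q ∈ S) :
    IsControl S T (fun t => a • u t + b • v t) :=
  ⟨(hu.integrable.smul a).add (hv.integrable.smul b), by
    filter_upwards [hu.mem, hv.mem] with t h1 h2 using hS _ h1 _ h2⟩

theorem intervalIntegrable_toEuclideanLin_comp {k l : ℕ} (M : Matrix (Fin k) (Fin l) ℝ)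
    {f : ℝ → EuclideanSpace ℝ (Fin l)} {a b : ℝ} (hf : IntervalIntegrable f volume a b) :
    IntervalIntegrable (fun t => M.toEuclideanLin (f t)) volume a b :=
  let L := LinearMap.toContinuousLinearMap M.toEuclideanLin
  ⟨L.integrable_comp hf.1, L.integrable_comp hf.2⟩

theorem IsTrajectory.apply_zero (hx : IsTrajectory A B T x0 x u) (hT : 0 ≤ T) : x 0 = x0 := by
  simpa using hx.eq 0 ⟨le_rfl, hT⟩

theorem IsTrajectory.intervalIntegrable_state (hx : IsTrajectory A B T x0 x u) (hT : 0 ≤ T) :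
    IntervalIntegrable x volume 0 T :=
  ContinuousOn.intervalIntegrable (by simpa [uIcc_of_le hT] using hx.cont)

theorem IsTrajectory.intervalIntegrable (hx : IsTrajectory A B T x0 x u) (hu : IsControl U T u)
    (hT : 0 ≤ T) :
    IntervalIntegrable (fun s => A.toEuclideanLin (x s) + B.toEuclideanLin (u s)) volume 0 T :=
  (intervalIntegrable_toEuclideanLin_comp A (hx.intervalIntegrable_state hT)).add
    (intervalIntegrable_toEuclideanLin_comp B (hu.intervalIntegrable hT))

theorem IntervalIntegrable.of_mem_Icc {E : Type*} [NormedAddCommGroup E] {f : ℝ → E}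
    (hf : IntervalIntegrable f volume 0 T) (ht : t ∈ Icc 0 T) :
    IntervalIntegrable f volume 0 t :=
  hf.mono_set (by
    rw [uIcc_of_le ht.1, uIcc_of_le (ht.1.trans ht.2)]
    exact Icc_subset_Icc_right ht.2)

theorem isTrajectory_of_eq
    (hi : IntervalIntegrable (fun s => A.toEuclideanLin (x s) + B.toEuclideanLin (u s)) volume 0 T)
    (hT : 0 ≤ T)
    (h : ∀ t ∈ Icc 0 T,
      x t = x0 + ∫ s in (0 : ℝ)..t, (A.toEuclideanLin (x s) + B.toEuclideanLin (u s))) :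
    IsTrajectory A B T x0 x u := by
  refine ⟨?_, h⟩
  refine ContinuousOn.congr ?_ h
  refine continuousOn_const.add ?_
  have := intervalIntegral.continuousOn_primitive_interval'
    hi (a := 0) left_mem_uIcc
  rwa [uIcc_of_le hT] at this

theorem IsTrajectory.glue (hs : 0 ≤ s) (ht : 0 ≤ t) (hx : IsTrajectory A B s x0 x u)
    (hu : IsControl U s u) (hy : IsTrajectory A B t (x s) y v) (hv : IsControl V t v) :
    IsTrajectory A B (s + t) x0 (glue s x y) (glue s u v) := by
  have e := map_glue (fun a b => A.toEuclideanLin a + B.toEuclideanLin b) s x y u v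
  have i1 := hx.intervalIntegrable hu hs
  have i2 := hy.intervalIntegrable hv ht
  apply isTrajectory_of_eq _ (by linarith)
  · intro r hr
    rw [e]
    rcases le_or_gt r s with h | h
    · rw [glue_of_le _ _ h, hx.eq r ⟨hr.1, h⟩]
      congr 1
      refine intervalIntegral.integral_congr_uIoo fun q hq => ?_
      rw [uIoo_of_le hr.1] at hq
      rw [glue_of_le _ _ (hq.2.le.trans h)]
    · have hrs : r - s ∈ Icc 0 t := ⟨by linarith, by linarith [hr.2]⟩
      have h2 := integral_glue hs hrs.1 i1 (i2.of_mem_Icc hrs)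
      rw [add_sub_cancel] at h2
      rw [glue_of_lt _ _ h, h2, hy.eq _ hrs, hx.eq s ⟨hs, le_rfl⟩, add_assoc]
  · rw [e]
    exact intervalIntegrable_glue hs ht i1 i2

theorem IsTrajectory.linearCombination (hT : 0 ≤ T) (hx : IsTrajectory A B T x0 x u)
    (hu : IsControl U T u) (hy : IsTrajectory A B T y0 y v) (hv : IsControl V T v) (a b : ℝ) :
    IsTrajectory A B T (a • x0 + b • y0) (fun t => a • x t + b • y t)
      (fun t => a • u t + b • v t) := by
  refine ⟨(hx.cont.const_smul a).add (hy.cont.const_smul b), fun t ht => ?_⟩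
  have i1 := (hx.intervalIntegrable hu hT).of_mem_Icc ht
  have i2 := (hy.intervalIntegrable hv hT).of_mem_Icc ht
  have : ∫ s in (0 : ℝ)..t, (A.toEuclideanLin (a • x s + b • y s) +
      B.toEuclideanLin (a • u s + b • v s)) =
      a • (∫ s in (0 : ℝ)..t, (A.toEuclideanLin (x s) + B.toEuclideanLin (u s))) +
      b • ∫ s in (0 : ℝ)..t, (A.toEuclideanLin (y s) + B.toEuclideanLin (v s)) := by
    rw [← intervalIntegral.integral_smul, ← intervalIntegral.integral_smul,
      ← intervalIntegral.integral_add (by exact i1.smul a) (by exact i2.smul b)]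
    congr 1
    funext s
    simp only [map_add, map_smul, smul_add]
    abel
  simp only [hx.eq t ht, hy.eq t ht, this, smul_add]
  abel

theorem isTrajectory_const {c : EuclideanSpace ℝ (Fin m)}
    (h : A.toEuclideanLin x0 + B.toEuclideanLin c = 0) :
    IsTrajectory A B T x0 (fun _ => x0) (fun _ => c) :=
  ⟨continuousOn_const, fun t _ => by simp [h]⟩

/-- The flow `exp (t A)` of `ẋ = A x`. -/
noncomputable def freeFlow (A : Matrix (Fin n) (Fin n) ℝ) (t : ℝ) :
    EuclideanSpace ℝ (Fin n) →L[ℝ] EuclideanSpace ℝ (Fin n) :=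
  NormedSpace.exp (t • LinearMap.toContinuousLinearMap A.toEuclideanLin)

theorem freeFlow_zero (A : Matrix (Fin n) (Fin n) ℝ) : freeFlow A 0 = 1 := by
  have h : (0 : ℝ) • LinearMap.toContinuousLinearMap A.toEuclideanLin = 0 := by
    ext
    simp
  rw [freeFlow, h]
  exact NormedSpace.exp_zero

theorem isTrajectory_freeFlow (A : Matrix (Fin n) (Fin n) ℝ) (B : Matrix (Fin n) (Fin m) ℝ)
    (T : ℝ) (x0 : EuclideanSpace ℝ (Fin n)) :
    IsTrajectory A B T x0 (fun t => freeFlow A t x0) (fun _ => 0) := by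
  set L := LinearMap.toContinuousLinearMap A.toEuclideanLin with hL
  have hd : ∀ t, HasDerivAt (fun t => freeFlow A t x0) (A.toEuclideanLin (freeFlow A t x0)) t := by
    intro t
    have h := hasDerivAt_exp_smul_const' (𝕂 := ℝ) L t
    exact h.clm_apply (hasDerivAt_const t x0) |>.congr_deriv (by simp [hL, freeFlow])
  have hc : Continuous (fun t => freeFlow A t x0) :=
    continuous_iff_continuousAt.2 fun t => (hd t).continuousAt
  refine ⟨hc.continuousOn, fun t _ => ?_⟩
  have hc' : Continuous fun t => A.toEuclideanLin (freeFlow A t x0) := L.continuous.comp hc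
  have := intervalIntegral.integral_eq_sub_of_hasDerivAt (a := 0) (b := t) (fun s _ => hd s)
    (hc'.intervalIntegrable 0 t)
  simp only [map_zero, add_zero, this]
  simp [freeFlow_zero]

theorem freeFlow_injective (A : Matrix (Fin n) (Fin n) ℝ) (t : ℝ) :
    Function.Injective (freeFlow A t) := by
  set X := t • LinearMap.toContinuousLinearMap A.toEuclideanLin with hX
  have h : NormedSpace.exp (-X) * NormedSpace.exp X = 1 := by
    let := NormedAlgebra.restrictScalars ℚ ℝ
      (EuclideanSpace ℝ (Fin n) →L[ℝ] EuclideanSpace ℝ (Fin n))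
    rw [← NormedSpace.exp_add_of_commute (Commute.refl X).neg_left]
    simp
  have h' : ∀ a, NormedSpace.exp (-X) (freeFlow A t a) = a := fun a =>
    congrArg (fun L : EuclideanSpace ℝ (Fin n) →L[ℝ] EuclideanSpace ℝ (Fin n) => L a) h
  exact Function.LeftInverse.injective h'

end Trajectory

/-! ### Null-controllable states and continuous steering times. -/

section ControllableSets

open Filter Topology Metric

variable {n m : ℕ} {A : Matrix (Fin n) (Fin n) ℝ} {B : Matrix (Fin n) (Fin m) ℝ}
  {U V S : Set (EuclideanSpace ℝ (Fin m))} {s t : ℝ} {ξ η z w : EuclideanSpace ℝ (Fin n)}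

theorem controllableSetAt_mono (hU : U ⊆ V) :
    controllableSetAt A B U t z ⊆ controllableSetAt A B V t z := by
  rintro ξ ⟨x, u, hu, hx, h⟩
  exact ⟨x, u, hu.mono hU, hx, h⟩

theorem controllableSetAt_trans (hs : 0 ≤ s) (ht : 0 ≤ t) (h1 : ξ ∈ controllableSetAt A B U s z)
    (h2 : z ∈ controllableSetAt A B U t w) : ξ ∈ controllableSetAt A B U (s + t) w := by
  obtain ⟨x, u, hu, hx, rfl⟩ := h1
  obtain ⟨y, v, hv, hy, rfl⟩ := h2
  exact ⟨_, _, hu.glue hs ht hv, hx.glue hs ht hu hy hv, glue_add_of_eq ht (hy.apply_zero ht)⟩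

/-- Superposition. The three control sets are kept separate so that an admissible control can be
combined with a zero, constant or small one. -/
theorem controllableSetAt_linearCombination (ht : 0 ≤ t) (h1 : ξ ∈ controllableSetAt A B U t z)
    (h2 : η ∈ controllableSetAt A B V t w) (a b : ℝ)
    (hS : ∀ p ∈ U, ∀ q ∈ V, a • p + b • q ∈ S) :
    a • ξ + b • η ∈ controllableSetAt A B S t (a • z + b • w) := by
  obtain ⟨x, u, hu, hx, rfl⟩ := h1
  obtain ⟨y, v, hv, hy, rfl⟩ := h2
  exact ⟨_, _, hu.linearCombination hv a b hS, hx.linearCombination ht hu hy hv a b, rfl⟩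

theorem mem_controllableSetAt_of_steady {c : EuclideanSpace ℝ (Fin m)} (hc : c ∈ U)
    (h : A.toEuclideanLin z + B.toEuclideanLin c = 0) (t : ℝ) :
    z ∈ controllableSetAt A B U t z :=
  ⟨_, _, isControl_const hc, isTrajectory_const h, rfl⟩

/-- Spare time is spent waiting at the steady state after arrival. -/
theorem controllableSetAt_subset_of_le {c : EuclideanSpace ℝ (Fin m)} (hc : c ∈ U)
    (h : A.toEuclideanLin z + B.toEuclideanLin c = 0) (hs : 0 ≤ s) (hst : s ≤ t) :
    controllableSetAt A B U s z ⊆ controllableSetAt A B U t z := by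
  intro ξ hξ
  have := controllableSetAt_trans hs (sub_nonneg.2 hst) hξ
    (mem_controllableSetAt_of_steady hc h (t - s))
  rwa [add_sub_cancel] at this

theorem mem_controllableSetAt_freeFlow (A : Matrix (Fin n) (Fin n) ℝ)
    (B : Matrix (Fin n) (Fin m) ℝ) (t : ℝ) (ξ : EuclideanSpace ℝ (Fin n)) :
    ξ ∈ controllableSetAt A B {0} t (freeFlow A t ξ) :=
  ⟨_, _, isControl_const rfl, isTrajectory_freeFlow A B t ξ, rfl⟩

theorem mem_controllableSet_iff {Φ : Set (EuclideanSpace ℝ (Fin n))} :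
    ξ ∈ controllableSet A B U Φ ↔ ∃ z ∈ Φ, ∃ t, 0 ≤ t ∧ ξ ∈ controllableSetAt A B U t z := by
  simp [controllableSet]

/-- The subspace of states that can be steered to `0` at time `t` by a bounded control. -/
def nullControllable (A : Matrix (Fin n) (Fin n) ℝ) (B : Matrix (Fin n) (Fin m) ℝ) (t : ℝ≥0) :
    Submodule ℝ (EuclideanSpace ℝ (Fin n)) where
  carrier := {ξ | ∃ c, ξ ∈ controllableSetAt A B (closedBall 0 c) t 0}
  zero_mem' := ⟨0, mem_controllableSetAt_of_steady (c := 0) (by simp) (by simp) t⟩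
  add_mem' := by
    rintro ξ η ⟨c, hξ⟩ ⟨d, hη⟩
    refine ⟨c + d, ?_⟩
    have := controllableSetAt_linearCombination (S := closedBall 0 (c + d)) t.2 hξ hη 1 1
      fun p hp q hq => by
        simp only [mem_closedBall, dist_zero_right, one_smul] at *
        exact (norm_add_le _ _).trans (add_le_add hp hq)
    simpa using this
  smul_mem' := by
    rintro a ξ ⟨c, hξ⟩
    refine ⟨|a| * c, ?_⟩
    have := controllableSetAt_linearCombination (S := closedBall 0 (|a| * c)) t.2 hξ hξ a 0
      fun p hp q hq => by
        simp only [mem_closedBall, dist_zero_right, zero_smul, add_zero, norm_smul,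
          Real.norm_eq_abs] at *
        gcongr
    simpa using this

theorem mem_nullControllable {t : ℝ≥0} :
    ξ ∈ nullControllable A B t ↔ ∃ c, ξ ∈ controllableSetAt A B (closedBall 0 c) t 0 :=
  Iff.rfl

theorem nullControllable_mono (A : Matrix (Fin n) (Fin n) ℝ) (B : Matrix (Fin n) (Fin m) ℝ) :
    Monotone (nullControllable A B) := by
  rintro s t hst ξ ⟨c, hξ⟩
  -- The absolute value puts `0` in the ball, as waiting at the origin requires; `c` can be negative
  -- when `s = 0`, where the control constraint is void.
  have hξ' := controllableSetAt_mono (V := closedBall 0 |c|)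
    (closedBall_subset_closedBall (le_abs_self c)) hξ
  exact ⟨|c|, controllableSetAt_subset_of_le (c := 0) (by simp) (by simp) s.2
    (NNReal.coe_le_coe.2 hst) hξ'⟩

/-- In finite dimension, one time suffices for the null-controllable states. -/
theorem exists_nullControllable_le (A : Matrix (Fin n) (Fin n) ℝ)
    (B : Matrix (Fin n) (Fin m) ℝ) :
    ∃ N : ℝ≥0, ∀ t, nullControllable A B t ≤ nullControllable A B N := by
  let f : ℕ →o Submodule ℝ (EuclideanSpace ℝ (Fin n)) :=
    ⟨fun k => nullControllable A B k, fun i j h => nullControllable_mono A B (by exact_mod_cast h)⟩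
  -- The increasing chain of subspaces at integer times stabilizes; a real time lies below its
  -- ceiling.
  obtain ⟨N, hN⟩ := monotone_stabilizes_iff_noetherian.2
    (inferInstance : IsNoetherian ℝ (EuclideanSpace ℝ (Fin n))) f
  refine ⟨N, fun t => ?_⟩
  have h := hN (max N ⌈t⌉₊) (le_max_left _ _)
  change nullControllable A B N = nullControllable A B _ at h
  rw [h]
  refine nullControllable_mono A B ((Nat.le_ceil t).trans ?_)
  exact_mod_cast le_max_right _ _

/-- Flowing freely and then steering to `0` shows that the preimage of the subspace under `exp (t
A)` is contained in it. Since `exp (t A)` is invertible, the dimensions agree, so the two are equal;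
this yields forward invariance as well. -/
theorem freeFlow_mem_nullControllable {N : ℝ≥0}
    (hN : ∀ t, nullControllable A B t ≤ nullControllable A B N) (t : ℝ≥0)
    (hξ : ξ ∈ nullControllable A B N) : freeFlow A t ξ ∈ nullControllable A B N := by
  let e := LinearEquiv.ofInjectiveEndo
    ((freeFlow A t : EuclideanSpace ℝ (Fin n) →L[ℝ] EuclideanSpace ℝ (Fin n)) :
      EuclideanSpace ℝ (Fin n) →ₗ[ℝ] EuclideanSpace ℝ (Fin n))
    (freeFlow_injective A t)
  have h1 : (nullControllable A B N).comap e.toLinearMap ≤ nullControllable A B N := by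
    rintro η ⟨c, hη⟩
    refine hN (t + N) ?_
    refine ⟨|c|, ?_⟩
    rw [NNReal.coe_add]
    refine controllableSetAt_trans t.2 N.2
      (controllableSetAt_mono ?_ (mem_controllableSetAt_freeFlow A B t η))
      (controllableSetAt_mono (closedBall_subset_closedBall (le_abs_self c)) hη)
    simp
  have h2 : Module.finrank ℝ ((nullControllable A B N).comap e.toLinearMap) =
      Module.finrank ℝ (nullControllable A B N) := by
    rw [Submodule.comap_equiv_eq_map_symm]
    exact LinearEquiv.finrank_map_eq e.symm _
  have h3 := Submodule.eq_of_le_of_finrank_eq h1 h2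
  rw [← h3] at hξ
  exact hξ

/-- Fix one bounded steering control for each vector of a basis. Superposing them with the
coordinates of `ξ` gives a control whose bound tends to `0` with `ξ`. -/
theorem exists_steering_of_small {N : ℝ≥0} {r : ℝ} (hr : 0 < r) :
    ∃ δ > 0, ∀ ξ ∈ nullControllable A B N, ‖ξ‖ < δ →
      ξ ∈ controllableSetAt A B (closedBall 0 r) N 0 := by
  set M := nullControllable A B N with hM
  let b := Module.finBasis ℝ M
  choose c hc using fun i => mem_nullControllable.1 (b i).2
  have hsum : ∀ (a : Fin (Module.finrank ℝ M) → ℝ) (s : Finset (Fin (Module.finrank ℝ M))),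
      ∑ i ∈ s, a i • (b i : EuclideanSpace ℝ (Fin n)) ∈
        controllableSetAt A B (closedBall 0 (∑ i ∈ s, |a i| * c i)) N 0 := by
    intro a s
    induction s using Finset.induction_on with
    | empty => exact mem_controllableSetAt_of_steady (c := 0) (by simp) (by simp) N
    | insert i s hi ih =>
      rw [Finset.sum_insert hi, Finset.sum_insert hi]
      have := controllableSetAt_linearCombination
        (S := closedBall 0 (|a i| * c i + ∑ i ∈ s, |a i| * c i)) N.2 (hc i) ih (a i) 1
        fun p hp q hq => by
          simp only [mem_closedBall, dist_zero_right, one_smul] at *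
          refine (norm_add_le _ _).trans (add_le_add ?_ hq)
          rw [norm_smul, Real.norm_eq_abs]
          gcongr
      simpa using this
  have hcont : Continuous fun ξ : M => ∑ i, |b.coord i ξ| * c i := by
    refine continuous_finsetSum _ fun i _ => ?_
    exact ((LinearMap.continuous_of_finiteDimensional (b.coord i)).abs).mul continuous_const
  have h0 : ∀ᶠ ξ : M in 𝓝 0, ∑ i, |b.coord i ξ| * c i < r := by
    refine hcont.continuousAt.eventually_lt continuousAt_const ?_
    simpa using hr
  obtain ⟨δ, hδ, h⟩ := Metric.eventually_nhds_iff.1 h0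
  refine ⟨δ, hδ, fun ξ hξ hn => ?_⟩
  have h1 := h (y := ⟨ξ, hξ⟩) (by simpa [dist_zero_right] using hn)
  have h2 := hsum (fun i => b.coord i ⟨ξ, hξ⟩) Finset.univ
  have h3 : ∑ i, b.coord i ⟨ξ, hξ⟩ • (b i : EuclideanSpace ℝ (Fin n)) = ξ := by
    have := congrArg M.subtype (b.sum_repr ⟨ξ, hξ⟩)
    rw [map_sum] at this
    exact this
  rw [h3] at h2
  exact controllableSetAt_mono (closedBall_subset_closedBall h1.le) h2

/-- Near a state that can be steered to an interior steady state, all such states can be steered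
there within a common time. -/
theorem exists_eventually_mem_controllableSetAt (hU : Bornology.IsBounded U)
    {xe x0 : EuclideanSpace ℝ (Fin n)} {ue : EuclideanSpace ℝ (Fin m)} (hue : ue ∈ interior U)
    (hs : A.toEuclideanLin xe + B.toEuclideanLin ue = 0)
    (hx0 : x0 ∈ controllableSet A B U {xe}) :
    ∃ τ : ℝ, 0 ≤ τ ∧ ∀ᶠ y in 𝓝 x0,
      y ∈ controllableSet A B U {xe} → y ∈ controllableSetAt A B U τ xe := by
  obtain ⟨C, hC⟩ := hU.subset_closedBall (0 : EuclideanSpace ℝ (Fin m))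
  obtain ⟨N, hN⟩ := exists_nullControllable_le A B
  have hsub : ∀ y ∈ controllableSet A B U {xe}, y - xe ∈ nullControllable A B N := by
    intro y hy
    obtain ⟨z, hz, s, h0s, hys⟩ := mem_controllableSet_iff.1 hy
    obtain rfl : z = xe := hz
    refine hN ⟨s, h0s⟩ ⟨C + ‖ue‖, ?_⟩
    -- Subtracting the resting trajectory turns steering to `xe` into steering to `0`.
    have := controllableSetAt_linearCombination (S := closedBall 0 (C + ‖ue‖)) h0s hys
      (mem_controllableSetAt_of_steady (mem_singleton ue) hs s) 1 (-1) fun p hp q hq => by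
        obtain rfl : q = ue := hq
        have hp := hC hp
        simp only [mem_closedBall, dist_zero_right, one_smul] at *
        refine (norm_add_le _ _).trans ?_
        rw [neg_smul, one_smul, norm_neg]
        gcongr
    rw [one_smul, neg_smul, one_smul, one_smul, add_neg_cancel,
      ← sub_eq_add_neg] at this
    exact this
  obtain ⟨r, hr, hrU⟩ := Metric.nhds_basis_closedBall.mem_iff.1 (mem_interior_iff_mem_nhds.1 hue)
  obtain ⟨δ, hδ, hsmall⟩ := exists_steering_of_small (A := A) (B := B) (N := N) hr
  have hx0' := hsub x0 hx0
  obtain ⟨z, hz, t, h0t, hx0t⟩ := mem_controllableSet_iff.1 hx0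
  obtain rfl : z = xe := hz
  -- Up to time `t` the control of `x0` is reused, taking `y` to `xe` plus the free flow of `y -
  -- x0`. During the remaining time `N` a small correction around `ue` removes this error.
  refine ⟨t + N, by positivity, ?_⟩
  have hc : Continuous fun y => ‖freeFlow A t (y - x0)‖ := by fun_prop
  have he : ∀ᶠ y in 𝓝 x0, ‖freeFlow A t (y - x0)‖ < δ :=
    hc.continuousAt.eventually_lt continuousAt_const (by simpa using hδ)
  filter_upwards [he] with y hyδ hy
  have hyx : y - x0 ∈ nullControllable A B N := by
    simpa using sub_mem (hsub y hy) hx0'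
  have hη := hsmall _ (freeFlow_mem_nullControllable hN ⟨t, h0t⟩ hyx) hyδ
  have h1 := controllableSetAt_linearCombination (S := U) h0t hx0t
    (mem_controllableSetAt_freeFlow A B t (y - x0)) 1 1 fun p hp q hq => by
      obtain rfl : q = 0 := hq
      simpa using hp
  have h2 := controllableSetAt_linearCombination (S := U) N.2
    (mem_controllableSetAt_of_steady (mem_singleton ue) hs N) hη 1 1 fun p hp q hq => by
      obtain rfl : p = ue := hp
      refine hrU ?_
      simpa [mem_closedBall, dist_eq_norm] using hq
  simp only [one_smul, add_zero, add_sub_cancel] at h1 h2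
  exact controllableSetAt_trans h0t N.2 h1 h2

/-- There is a continuous upper bound for the time needed to steer to an interior steady state. -/
theorem exists_continuous_mem_controllableSetAt (hU : Bornology.IsBounded U)
    {xe : EuclideanSpace ℝ (Fin n)} {ue : EuclideanSpace ℝ (Fin m)} (hue : ue ∈ interior U)
    (hs : A.toEuclideanLin xe + B.toEuclideanLin ue = 0) :
    ∃ τ : controllableSet A B U {xe} → ℝ, Continuous τ ∧ ∀ x0, 0 ≤ τ x0 ∧
      (x0 : EuclideanSpace ℝ (Fin n)) ∈ controllableSetAt A B U (τ x0) xe := by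
  -- Because waiting is allowed, the admissible times form an upward closed, hence convex, set.
  -- Locally constant choices can therefore be averaged by a partition of unity.
  have hconv : ∀ x0 : controllableSet A B U {xe}, Convex ℝ {τ : ℝ | 0 ≤ τ ∧
      (x0 : EuclideanSpace ℝ (Fin n)) ∈ controllableSetAt A B U τ xe} := by
    intro x0
    refine OrdConnected.convex ⟨fun a ha b _ c hc => ⟨ha.1.trans hc.1, ?_⟩⟩
    exact controllableSetAt_subset_of_le (interior_subset hue) hs ha.1 hc.1 ha.2
  obtain ⟨g, hg⟩ := exists_continuous_forall_mem_convex_of_local_const hconv fun x0 => by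
    obtain ⟨τ, h0, h⟩ := exists_eventually_mem_controllableSetAt hU hue hs x0.2
    refine ⟨τ, ?_⟩
    filter_upwards [continuous_subtype_val.continuousAt.eventually h] with y hy
    exact ⟨h0, hy y.2⟩
  exact ⟨g, g.continuous, hg⟩

end ControllableSets

/-! ### The chain rule for quadratic energies and Grönwall's inequality. -/

section Energy

open Filter Topology Metric
open scoped RealInnerProductSpace

/-- The velocity is only integrable and essentially bounded, so the classical chain rule does not
apply. The bound makes the curve, and then its quadratic energy, Lipschitz; absolute continuity
gives the fundamental theorem and the product rule holds almost everywhere. -/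
theorem integral_two_mul_inner_eq_sub {E : Type*} [NormedAddCommGroup E] [InnerProductSpace ℝ E]
    [CompleteSpace E] {S : E →L[ℝ] E} (hS : ∀ a b, ⟪S a, b⟫ = ⟪a, S b⟫) {T K : ℝ} (hT : 0 ≤ T)
    {x f : ℝ → E} {x0 : E} (hf : IntervalIntegrable f volume 0 T)
    (hK : ∀ᵐ t, t ∈ Icc 0 T → ‖f t‖ ≤ K)
    (hx : ∀ t ∈ Icc 0 T, x t = x0 + ∫ s in (0 : ℝ)..t, f s) :
    ∫ t in (0 : ℝ)..T, 2 * ⟪S (x t), f t⟫ = ⟪S (x T), x T⟫ - ⟪S x0, x0⟫ := by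
  -- The primitive `y` agrees with `x` on `[0, T]` and can be differentiated without using values of
  -- `x` outside.
  set y : ℝ → E := fun t => x0 + ∫ s in (0 : ℝ)..t, f s with hy
  set h : ℝ → ℝ := fun t => ⟪S (y t), y t⟫ with hh
  have hsubset : ∀ a ∈ Icc 0 T, ∀ b ∈ Icc 0 T, uIoc a b ⊆ Icc 0 T := fun a ha b hb =>
    uIoc_subset_uIcc.trans (uIcc_subset_Icc ha hb)
  have hylip : ∀ a ∈ Icc 0 T, ∀ b ∈ Icc 0 T, ‖y a - y b‖ ≤ K * |a - b| := by
    intro a ha b hb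
    have : y a - y b = ∫ s in b..a, f s := by
      rw [← intervalIntegral.integral_interval_sub_left (hf.of_mem_Icc ha) (hf.of_mem_Icc hb)]
      simp [hy]
    rw [this]
    refine intervalIntegral.norm_integral_le_of_norm_le_const_ae ?_
    filter_upwards [hK] with t ht htm using ht (hsubset b hb a ha htm)
  have hycont : ContinuousOn y (Icc 0 T) := by
    have := intervalIntegral.continuousOn_primitive_interval' hf (a := 0) left_mem_uIcc
    rw [uIcc_of_le hT] at this
    exact continuousOn_const.add this
  obtain ⟨X, hX⟩ := isCompact_Icc.exists_bound_of_continuousOn hycont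
  have hX0 : 0 ≤ X := (norm_nonneg _).trans (hX 0 ⟨le_rfl, hT⟩)
  have hlip : LipschitzOnWith (Real.toNNReal (2 * ‖S‖ * X * K)) h (uIcc 0 T) := by
    rw [uIcc_of_le hT]
    refine LipschitzOnWith.of_dist_le_mul fun a ha b hb => ?_
    have e : h a - h b = ⟪S (y a - y b), y a⟫ + ⟪S (y b), y a - y b⟫ := by
      simp only [hh, map_sub, inner_sub_left, inner_sub_right]
      ring
    have h1 : |⟪S (y a - y b), y a⟫| ≤ ‖S‖ * ‖y a - y b‖ * X :=
      (abs_real_inner_le_norm _ _).trans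
        (mul_le_mul (S.le_opNorm _) (hX a ha) (norm_nonneg _) (by positivity))
    have h2 : |⟪S (y b), y a - y b⟫| ≤ ‖S‖ * X * ‖y a - y b‖ := by
      refine (abs_real_inner_le_norm _ _).trans ?_
      gcongr
      exact (S.le_opNorm _).trans (by gcongr; exact hX b hb)
    calc dist (h a) (h b) = |h a - h b| := Real.dist_eq _ _
      _ ≤ 2 * ‖S‖ * X * ‖y a - y b‖ := by
        rw [e]
        refine (abs_add_le _ _).trans ?_
        linarith
      _ ≤ 2 * ‖S‖ * X * (K * |a - b|) := by
        gcongr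
        exact hylip a ha b hb
      _ = (2 * ‖S‖ * X * K) * dist a b := by rw [Real.dist_eq]; ring
      _ ≤ _ := by
        gcongr
        exact Real.le_coe_toNNReal _
  have hend : ∫ t in (0 : ℝ)..T, deriv h t = h T - h 0 :=
    hlip.absolutelyContinuousOnInterval.integral_deriv_eq_sub
  have hT' : x T = y T := hx T ⟨hT, le_rfl⟩
  have h0 : y 0 = x0 := by simp [hy]
  rw [hT', ← h0]
  refine Eq.trans ?_ hend
  refine intervalIntegral.integral_congr_ae ?_
  filter_upwards [hf.ae_hasDerivAt_integral] with t ht htm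
  have htI : t ∈ Icc 0 T := hsubset 0 ⟨le_rfl, hT⟩ T ⟨hT, le_rfl⟩ htm
  have hd : HasDerivAt y (f t) t :=
    (ht (by rwa [uIcc_of_le hT]) 0 left_mem_uIcc).const_add x0
  have hd' : HasDerivAt h (⟪S (y t), f t⟫ + ⟪S (f t), y t⟫) t :=
    (S.hasFDerivAt.comp_hasDerivAt t hd).inner ℝ hd
  rw [hd'.deriv, hx t htI, hS (f t), real_inner_comm (f t)]
  ring

/-- Grönwall's inequality in integral form. -/
theorem norm_le_mul_exp_of_norm_le_integral {E : Type*} [NormedAddCommGroup E] {T a ε : ℝ}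
    (ha : 0 < a) {x : ℝ → E} (hx : ContinuousOn x (Icc 0 T))
    (h : ∀ t ∈ Icc 0 T, ‖x t‖ ≤ ε + a * ∫ s in (0 : ℝ)..t, ‖x s‖) {t : ℝ} (ht : t ∈ Icc 0 T) :
    ‖x t‖ ≤ ε * Real.exp (a * t) := by
  have hT : 0 ≤ T := ht.1.trans ht.2
  -- Clamping time to `[0, T]` makes `x ∘ p` continuous on the line, so its primitive is
  -- differentiable everywhere.
  set p : ℝ → ℝ := fun t => max 0 (min t T) with hp
  have hpm : ∀ t, p t ∈ Icc 0 T := fun t => ⟨le_max_left _ _, max_le hT (min_le_right _ _)⟩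
  have hpe : ∀ t ∈ Icc 0 T, p t = t := fun t ht => by
    simp only [hp]
    rw [min_eq_left ht.2, max_eq_right ht.1]
  have hc : Continuous fun t => ‖x (p t)‖ :=
    (hx.comp_continuous (by fun_prop) hpm).norm
  have hint : ∀ t ∈ Icc 0 T, ∫ s in (0 : ℝ)..t, ‖x s‖ = ∫ s in (0 : ℝ)..t, ‖x (p s)‖ := by
    intro t ht
    refine intervalIntegral.integral_congr fun s hs => ?_
    rw [uIcc_of_le ht.1] at hs
    rw [hpe s ⟨hs.1, hs.2.trans ht.2⟩]
  set g : ℝ → ℝ := fun t => ∫ s in (0 : ℝ)..t, ‖x (p s)‖ with hg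
  have hd : ∀ t, HasDerivAt g ‖x (p t)‖ t := fun t =>
    intervalIntegral.integral_hasDerivAt_right (hc.intervalIntegrable _ _)
      (hc.stronglyMeasurableAtFilter _ _) hc.continuousAt
  have hg0 : ∀ t ∈ Icc 0 T, 0 ≤ g t := fun t ht =>
    intervalIntegral.integral_nonneg ht.1 fun _ _ => norm_nonneg _
  have hbound := norm_le_gronwallBound_of_norm_deriv_right_le (f := g)
    (f' := fun t => ‖x (p t)‖) (δ := 0) (K := a) (ε := ε) (a := 0) (b := T)
    (fun t _ => (hd t).continuousAt.continuousWithinAt) (fun t _ => (hd t).hasDerivWithinAt)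
    (by simp [hg]) (fun t ht => by
      have ht' : t ∈ Icc 0 T := Ico_subset_Icc_self ht
      have := h t ht'
      rw [hint t ht'] at this
      rw [norm_norm, hpe t ht', Real.norm_of_nonneg (hg0 t ht')]
      linarith) t ht
  rw [Real.norm_of_nonneg (hg0 t ht), gronwallBound_of_K_ne_0 ha.ne', sub_zero] at hbound
  have h1 := h t ht
  rw [hint t ht] at h1
  have h2 : a * g t ≤ a * (0 * Real.exp (a * t) + ε / a * (Real.exp (a * t) - 1)) := by gcongr
  have h3 : a * (0 * Real.exp (a * t) + ε / a * (Real.exp (a * t) - 1)) =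
      ε * Real.exp (a * t) - ε := by
    field_simp
    ring
  change ‖x t‖ ≤ ε + a * g t at h1
  linarith

end Energy

/-! ### A priori bounds and integrability along trajectories. -/

section Trajectories

open Metric

variable {n m : ℕ} {A : Matrix (Fin n) (Fin n) ℝ} {B : Matrix (Fin n) (Fin m) ℝ}
  {U : Set (EuclideanSpace ℝ (Fin m))} {T : ℝ} {x0 : EuclideanSpace ℝ (Fin n)}
  {x : ℝ → EuclideanSpace ℝ (Fin n)} {u : ℝ → EuclideanSpace ℝ (Fin m)}

theorem exists_norm_toEuclideanLin_le {k l : Type*} [Fintype k] [Fintype l] [DecidableEq l]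
    (M : Matrix k l ℝ) : ∃ a > 0, ∀ z, ‖M.toEuclideanLin z‖ ≤ a * ‖z‖ := by
  let L := LinearMap.toContinuousLinearMap M.toEuclideanLin
  -- The added `1` makes the constant positive; Grönwall's inequality divides by it.
  refine ⟨‖L‖ + 1, by positivity, fun z => (L.le_opNorm z).trans ?_⟩
  gcongr
  linarith

/-- Grönwall with explicit constants: the bound is continuous in `T` and `x0`, which is what the
later cost estimate needs. -/
theorem IsTrajectory.norm_le (hT : 0 ≤ T) {a b C : ℝ} (ha : 0 < a) (hb : 0 < b)
    (hA : ∀ z, ‖A.toEuclideanLin z‖ ≤ a * ‖z‖) (hB : ∀ z, ‖B.toEuclideanLin z‖ ≤ b * ‖z‖)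
    (hx : IsTrajectory A B T x0 x u) (hu : IsControl (closedBall 0 C) T u) (hC : 0 ≤ C)
    {t : ℝ} (ht : t ∈ Icc 0 T) :
    ‖x t‖ ≤ (‖x0‖ + b * C * T) * Real.exp (a * T) := by
  have h : ∀ t ∈ Icc 0 T, ‖x t‖ ≤ (‖x0‖ + b * C * T) + a * ∫ s in (0 : ℝ)..t, ‖x s‖ := by
    intro t ht
    have iA := (hx.intervalIntegrable_state hT).of_mem_Icc ht
    have h1 : ‖∫ s in (0 : ℝ)..t, (A.toEuclideanLin (x s) + B.toEuclideanLin (u s))‖ ≤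
        ∫ s in (0 : ℝ)..t, (a * ‖x s‖ + b * C) := by
      refine intervalIntegral.norm_integral_le_of_norm_le ht.1 ?_
        ((iA.norm.const_mul a).add intervalIntegrable_const)
      filter_upwards [hu.ae_mem] with s hs hst
      have hs' := hs ⟨hst.1.le, hst.2.trans ht.2⟩
      rw [mem_closedBall, dist_zero_right] at hs'
      refine (norm_add_le _ _).trans (add_le_add (hA _) ((hB _).trans ?_))
      gcongr
    rw [intervalIntegral.integral_add (iA.norm.const_mul a) intervalIntegrable_const,
      intervalIntegral.integral_const_mul, intervalIntegral.integral_const, sub_zero,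
      smul_eq_mul] at h1
    rw [hx.eq t ht]
    refine (norm_add_le _ _).trans ?_
    have : t * (b * C) ≤ b * C * T := by
      rw [mul_comm]
      gcongr
      exact ht.2
    linarith
  refine (norm_le_mul_exp_of_norm_le_integral ha hx.cont h ht).trans ?_
  have : 0 ≤ ‖x0‖ + b * C * T := by positivity
  gcongr
  exact ht.2

theorem IsControl.intervalIntegrable_comp (hT : 0 ≤ T) (hU : Bornology.IsBounded U)
    (hu : IsControl U T u) (hx : ContinuousOn x (Icc 0 T))
    {g : EuclideanSpace ℝ (Fin n) → EuclideanSpace ℝ (Fin m) → ℝ}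
    (hg : Continuous fun p : EuclideanSpace ℝ (Fin n) × EuclideanSpace ℝ (Fin m) => g p.1 p.2) :
    IntervalIntegrable (fun t => g (x t) (u t)) volume 0 T := by
  obtain ⟨C, hC⟩ := hU.subset_closedBall (0 : EuclideanSpace ℝ (Fin m))
  have hK : IsCompact ((x '' Icc 0 T) ×ˢ closedBall (0 : EuclideanSpace ℝ (Fin m)) C) :=
    (isCompact_Icc.image_of_continuousOn hx).prod (isCompact_closedBall _ _)
  obtain ⟨b, hb⟩ := hK.exists_bound_of_continuousOn hg.continuousOn
  rw [intervalIntegrable_iff_integrableOn_Icc_of_le hT]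
  refine Integrable.of_bound (C := b) ?_ ?_
  · exact hg.comp_aestronglyMeasurable
      ((hx.aestronglyMeasurable measurableSet_Icc).prodMk hu.integrable.aestronglyMeasurable)
  · filter_upwards [hu.mem, ae_restrict_mem measurableSet_Icc] with t h1 h2
    exact hb (x t, u t) ⟨mem_image_of_mem _ h2, hC h1⟩

end Trajectories

/-! ### Distance to the kernel and the pointwise power balance. -/

section PortHamiltonian

open Metric
open scoped RealInnerProductSpace

/-- With `W = Cᵀ C` the form is `‖C z‖²` and `W`, `C` have the same kernel. On the orthogonal
complement `C` is injective, hence bounded below in finite dimension, and the distance of `z` to the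
kernel is controlled by its orthogonal component. -/
theorem Matrix.PosSemidef.exists_sq_infDist_ker_le {ι : Type*} [Fintype ι] [DecidableEq ι]
    {W : Matrix ι ι ℝ} (hW : W.PosSemidef) :
    ∃ K ≥ 0, ∀ z : EuclideanSpace ℝ ι,
      infDist z (LinearMap.ker W.toEuclideanLin) ^ 2 ≤ K * ⟪z, W.toEuclideanLin z⟫ := by
  obtain ⟨C, hC⟩ : ∃ C : Matrix ι ι ℝ, W = Cᵀ * C := by
    open scoped MatrixOrder Matrix.Norms.L2Operator in
    obtain ⟨C, hC⟩ := CStarAlgebra.nonneg_iff_eq_star_mul_self.mp hW.nonneg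
    exact ⟨C, by rw [hC, Matrix.star_eq_conjTranspose, Matrix.conjTranspose_eq_transpose_of_trivial]⟩
  have hquad : ∀ z : EuclideanSpace ℝ ι, ⟪z, W.toEuclideanLin z⟫ = ‖C.toEuclideanLin z‖ ^ 2 := by
    intro z
    rw [← real_inner_self_eq_norm_sq, EuclideanSpace.inner_eq_star_dotProduct,
      EuclideanSpace.inner_eq_star_dotProduct, hC]
    simp only [Matrix.ofLp_toLpLin, Matrix.toLin'_apply, star_trivial]
    rw [← Matrix.mulVec_mulVec, dotProduct_comm, Matrix.dotProduct_mulVec, Matrix.vecMul_transpose]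
  set V := LinearMap.ker W.toEuclideanLin with hV
  have hker : ∀ z, z ∈ V ↔ C.toEuclideanLin z = 0 := by
    intro z
    constructor
    · intro hz
      have h := hquad z
      rw [LinearMap.mem_ker.1 hz, inner_zero_right] at h
      simpa using h.symm
    · intro hz
      rw [hV, LinearMap.mem_ker, hC, Matrix.toLpLin_mul_same]
      simp [hz]
  let f : Vᗮ →ₗ[ℝ] EuclideanSpace ℝ ι := C.toEuclideanLin.domRestrict Vᗮ
  have hf : LinearMap.ker f = ⊥ := by
    rw [LinearMap.ker_eq_bot']
    intro z hz
    have h1 : (z : EuclideanSpace ℝ ι) ∈ V := (hker _).2 hz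
    have h2 := Submodule.inner_right_of_mem_orthogonal h1 z.2
    exact Subtype.ext (inner_self_eq_zero.1 h2)
  obtain ⟨K, -, hK⟩ := f.exists_antilipschitzWith hf
  refine ⟨(K : ℝ) ^ 2, by positivity, fun z => ?_⟩
  obtain ⟨p, hp, q, hq, rfl⟩ := V.exists_add_mem_mem_orthogonal z
  have h1 : infDist (p + q) V ≤ ‖q‖ := by
    refine (infDist_le_dist_of_mem hp).trans ?_
    simp [dist_eq_norm]
  have h2 : ‖q‖ ≤ K * ‖C.toEuclideanLin (p + q)‖ := by
    have := hK.le_mul_dist ⟨q, hq⟩ 0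
    rw [map_add, (hker p).1 hp, zero_add]
    simpa [f] using this
  rw [hquad, ← mul_pow]
  gcongr
  · exact infDist_nonneg
  · exact h1.trans h2

variable {n m : ℕ}

theorem continuous_stack :
    Continuous fun p : EuclideanSpace ℝ (Fin n) × EuclideanSpace ℝ (Fin m) => stack p.1 p.2 := by
  refine (PiLp.continuous_toLp 2 _).comp (continuous_pi fun i => ?_)
  rcases i with i | i
  · simp only [Sum.elim_inl]
    fun_prop
  · simp only [Sum.elim_inr]
    fun_prop

/-- The power balance of a port-Hamiltonian system. -/
theorem supplyRate_eq {J R Q : Matrix (Fin n) (Fin n) ℝ} {B P : Matrix (Fin n) (Fin m) ℝ}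
    {D : Matrix (Fin m) (Fin m) ℝ} (hJ : J = -Jᵀ) (hQ : Qᵀ = Q)
    (x : EuclideanSpace ℝ (Fin n)) (u : EuclideanSpace ℝ (Fin m)) :
    supplyRate Q B P D x u =
      ⟪Q.toEuclideanLin x, ((J - R) * Q).toEuclideanLin x + (B - P).toEuclideanLin u⟫ +
      ⟪stack x u, (dissipationMatrix R Q P D).toEuclideanLin (stack x u)⟫ := by
  have hskew : ∀ q : Fin n → ℝ, q ⬝ᵥ J *ᵥ q = 0 := by
    intro q
    have h : q ⬝ᵥ J *ᵥ q = -(q ⬝ᵥ J *ᵥ q) := by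
      conv_lhs => rw [hJ]
      rw [Matrix.neg_mulVec, dotProduct_neg, Matrix.dotProduct_mulVec, Matrix.vecMul_transpose,
        dotProduct_comm]
    linarith
  have ht : ∀ {k l : ℕ} (M : Matrix (Fin k) (Fin l) ℝ) (p : Fin k → ℝ) (q : Fin l → ℝ),
      q ⬝ᵥ Mᵀ *ᵥ p = p ⬝ᵥ M *ᵥ q := by
    intro k l M p q
    rw [Matrix.dotProduct_mulVec, Matrix.vecMul_transpose, dotProduct_comm]
  have hQx : ∀ p q : Fin n → ℝ, p ⬝ᵥ Q *ᵥ q = (Q *ᵥ p) ⬝ᵥ q := by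
    intro p q
    rw [dotProduct_comm (Q *ᵥ p), ← ht Q, hQ]
  have hin : ∀ {k : Type} [Fintype k] (p q : EuclideanSpace ℝ k), ⟪p, q⟫ = p.ofLp ⬝ᵥ q.ofLp := by
    intro k _ p q
    rw [EuclideanSpace.inner_eq_star_dotProduct, star_trivial, dotProduct_comm]
  simp only [supplyRate, phOutput, stack, dissipationMatrix, symPart, hin, Matrix.ofLp_toLpLin,
    Matrix.toLin'_apply, WithLp.ofLp_add, Matrix.fromBlocks_mulVec, Sum.elim_comp_inl,
    Sum.elim_comp_inr]
  rw [show (x.ofLp : Fin n → ℝ) = fun i => x i from rfl, show u.ofLp = fun i => u i from rfl]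
  generalize (fun i => x i) = a
  generalize (fun i => u i) = b
  rw [sumElim_dotProduct_sumElim]
  simp only [← Matrix.mulVec_mulVec, Matrix.sub_mulVec, Matrix.add_mulVec, Matrix.transpose_add,
    dotProduct_add, dotProduct_sub, Matrix.smul_mulVec, dotProduct_smul, smul_eq_mul, hQx, hskew]
  simp only [ht]
  ring

end PortHamiltonian

/-! ### The integrated power balance and the cost of a transfer. -/

section Turnpike

open Metric
open scoped RealInnerProductSpace

variable {n m : ℕ} {J R Q : Matrix (Fin n) (Fin n) ℝ} {B P : Matrix (Fin n) (Fin m) ℝ}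
  {D : Matrix (Fin m) (Fin m) ℝ} {U : Set (EuclideanSpace ℝ (Fin m))} {T : ℝ}
  {x0 : EuclideanSpace ℝ (Fin n)} {x : ℝ → EuclideanSpace ℝ (Fin n)}
  {u : ℝ → EuclideanSpace ℝ (Fin m)}

theorem continuous_supplyRate (Q : Matrix (Fin n) (Fin n) ℝ) (B P : Matrix (Fin n) (Fin m) ℝ)
    (D : Matrix (Fin m) (Fin m) ℝ) :
    Continuous fun p : EuclideanSpace ℝ (Fin n) × EuclideanSpace ℝ (Fin m) =>
      supplyRate Q B P D p.1 p.2 := by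
  have h1 := LinearMap.continuous_of_finiteDimensional ((B + P)ᵀ * Q).toEuclideanLin
  have h2 := LinearMap.continuous_of_finiteDimensional D.toEuclideanLin
  exact continuous_snd.inner ((h1.comp continuous_fst).add (h2.comp continuous_snd))

theorem continuous_dissipation (W : Matrix (Fin n ⊕ Fin m) (Fin n ⊕ Fin m) ℝ) :
    Continuous fun p : EuclideanSpace ℝ (Fin n) × EuclideanSpace ℝ (Fin m) =>
      ⟪stack p.1 p.2, W.toEuclideanLin (stack p.1 p.2)⟫ :=
  continuous_stack.inner
    ((LinearMap.continuous_of_finiteDimensional W.toEuclideanLin).comp continuous_stack)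

theorem continuous_sq_infDist_stack (V : Set (EuclideanSpace ℝ (Fin n ⊕ Fin m))) :
    Continuous fun p : EuclideanSpace ℝ (Fin n) × EuclideanSpace ℝ (Fin m) =>
      infDist (stack p.1 p.2) V ^ 2 :=
  ((continuous_infDist_pt V).comp continuous_stack).pow 2

/-- The integrated power balance of a port-Hamiltonian system. -/
theorem integral_supplyRate_eq (hJ : J = -Jᵀ) (hQ : Qᵀ = Q) (hT : 0 ≤ T)
    (hU : Bornology.IsBounded U) (hu : IsControl U T u)
    (hx : IsTrajectory ((J - R) * Q) (B - P) T x0 x u) :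
    ∫ t in (0 : ℝ)..T, supplyRate Q B P D (x t) (u t) =
      (1 / 2) * ⟪Q.toEuclideanLin (x T), x T⟫ - (1 / 2) * ⟪Q.toEuclideanLin x0, x0⟫ +
      ∫ t in (0 : ℝ)..T,
        ⟪stack (x t) (u t), (dissipationMatrix R Q P D).toEuclideanLin (stack (x t) (u t))⟫ := by
  set f : ℝ → EuclideanSpace ℝ (Fin n) :=
    fun t => ((J - R) * Q).toEuclideanLin (x t) + (B - P).toEuclideanLin (u t) with hf
  have hfint : IntervalIntegrable f volume 0 T := hx.intervalIntegrable hu hT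
  obtain ⟨C, hC⟩ := hU.subset_closedBall (0 : EuclideanSpace ℝ (Fin m))
  obtain ⟨X, hX⟩ := isCompact_Icc.exists_bound_of_continuousOn hx.cont
  obtain ⟨a, ha, hA⟩ := exists_norm_toEuclideanLin_le ((J - R) * Q)
  obtain ⟨b, hb, hB⟩ := exists_norm_toEuclideanLin_le (B - P)
  have hbound : ∀ᵐ t, t ∈ Icc 0 T → ‖f t‖ ≤ a * X + b * C := by
    filter_upwards [hu.ae_mem] with t ht htm
    have h1 := hC (ht htm)
    rw [mem_closedBall, dist_zero_right] at h1
    refine (norm_add_le _ _).trans (add_le_add ((hA _).trans ?_) ((hB _).trans ?_))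
    · gcongr
      exact hX t htm
    · gcongr
  have hsymm : ∀ p q, ⟪LinearMap.toContinuousLinearMap Q.toEuclideanLin p, q⟫ =
      ⟪p, LinearMap.toContinuousLinearMap Q.toEuclideanLin q⟫ := by
    have : Q.IsHermitian := by
      rw [Matrix.IsHermitian, Matrix.conjTranspose_eq_transpose_of_trivial, hQ]
    exact Matrix.isSymmetric_toEuclideanLin_iff.2 this
  have key := integral_two_mul_inner_eq_sub hsymm hT hfint hbound hx.eq
  rw [intervalIntegral.integral_const_mul] at key
  simp only [LinearMap.coe_toContinuousLinearMap'] at key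
  have hsplit : ∀ t, supplyRate Q B P D (x t) (u t) = ⟪Q.toEuclideanLin (x t), f t⟫ +
      ⟪stack (x t) (u t), (dissipationMatrix R Q P D).toEuclideanLin (stack (x t) (u t))⟫ :=
    fun t => supplyRate_eq hJ hQ (x t) (u t)
  have i1 := hu.intervalIntegrable_comp hT hU hx.cont (continuous_supplyRate Q B P D)
  have i2 := hu.intervalIntegrable_comp hT hU hx.cont
    (g := fun a b => inner ℝ (stack a b) ((dissipationMatrix R Q P D).toEuclideanLin (stack a b)))
    (continuous_dissipation (dissipationMatrix R Q P D))
  have hdiff : ∫ t in (0 : ℝ)..T, ⟪Q.toEuclideanLin (x t), f t⟫ =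
      (∫ t in (0 : ℝ)..T, supplyRate Q B P D (x t) (u t)) - ∫ t in (0 : ℝ)..T,
        ⟪stack (x t) (u t), (dissipationMatrix R Q P D).toEuclideanLin (stack (x t) (u t))⟫ := by
    rw [← intervalIntegral.integral_sub i1 i2]
    simp only [hsplit, add_sub_cancel_right]
  linarith

/-- The cost of a transfer is bounded continuously in its duration and its initial state. -/
theorem exists_integral_supplyRate_le (A : Matrix (Fin n) (Fin n) ℝ)
    (G : Matrix (Fin n) (Fin m) ℝ) (Q : Matrix (Fin n) (Fin n) ℝ) (B P : Matrix (Fin n) (Fin m) ℝ)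
    (D : Matrix (Fin m) (Fin m) ℝ) (hU : Bornology.IsBounded U) :
    ∃ β : ℝ → EuclideanSpace ℝ (Fin n) → ℝ,
      (Continuous fun p : ℝ × EuclideanSpace ℝ (Fin n) => β p.1 p.2) ∧
      ∀ T x0 x u, 0 ≤ T → IsControl U T u → IsTrajectory A G T x0 x u →
        ∫ t in (0 : ℝ)..T, supplyRate Q B P D (x t) (u t) ≤ β T x0 := by
  obtain ⟨C', hC'⟩ := hU.subset_closedBall (0 : EuclideanSpace ℝ (Fin m))
  set C := |C'|
  have hC : U ⊆ closedBall 0 C := hC'.trans (closedBall_subset_closedBall (le_abs_self _))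
  have hC0 : 0 ≤ C := abs_nonneg _
  obtain ⟨a, ha, hA⟩ := exists_norm_toEuclideanLin_le A
  obtain ⟨b, hb, hB⟩ := exists_norm_toEuclideanLin_le G
  obtain ⟨k, hk, hk'⟩ := exists_norm_toEuclideanLin_le ((B + P)ᵀ * Q)
  obtain ⟨d, hd, hd'⟩ := exists_norm_toEuclideanLin_le D
  refine ⟨fun T x0 => C * (k * ((‖x0‖ + b * C * T) * Real.exp (a * T)) + d * C) * T,
    by fun_prop, fun T x0 x u hT hu hx => ?_⟩
  have i1 := hu.intervalIntegrable_comp hT hU hx.cont (continuous_supplyRate Q B P D)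
  set X := (‖x0‖ + b * C * T) * Real.exp (a * T)
  have : ‖∫ t in (0 : ℝ)..T, supplyRate Q B P D (x t) (u t)‖ ≤
      C * (k * X + d * C) * |T - 0| := by
    refine intervalIntegral.norm_integral_le_of_norm_le_const_ae ?_
    filter_upwards [hu.ae_mem] with t ht htm
    rw [uIoc_of_le hT] at htm
    have htm := Ioc_subset_Icc_self htm
    have h1 := hC (ht htm)
    rw [mem_closedBall, dist_zero_right] at h1
    have h2 := hx.norm_le hT ha hb hA hB (hu.mono hC) hC0 htm
    refine (norm_inner_le_norm _ _).trans ?_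
    gcongr
    refine (norm_add_le _ _).trans (add_le_add ((hk' _).trans ?_) ((hd' _).trans ?_))
    · gcongr
    · gcongr
  rw [sub_zero, abs_of_nonneg hT] at this
  exact (le_abs_self _).trans this

end Turnpike

/-! ### The turnpike estimate. -/

theorem theoremt {n m : ℕ}
    (J R Q : Matrix (Fin n) (Fin n) ℝ) (B P : Matrix (Fin n) (Fin m) ℝ)
    (D : Matrix (Fin m) (Fin m) ℝ)
    (hJ : J = -Jᵀ) (hR : R.PosSemidef) (hQ : Q.PosSemidef) (hS : (symPart D).PosSemidef)
    (hW : (dissipationMatrix R Q P D).PosSemidef)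
    (U : Set (EuclideanSpace ℝ (Fin m))) (hUconv : Convex ℝ U) (hUcomp : IsCompact U)
    (hU0 : (0 : EuclideanSpace ℝ (Fin m)) ∈ interior U)
    (Φ : Set (EuclideanSpace ℝ (Fin n))) (hΦ : IsClosed Φ)
    (xe : EuclideanSpace ℝ (Fin n)) (ue : EuclideanSpace ℝ (Fin m))
    (hopt : IsOptimalSteadyState J R Q B P D U xe ue)
    (hue : ue ∈ interior U)
    (hreach : xe ∈ controllableSet ((J - R) * Q) (B - P) U Φ) :
    (phOCP J R Q B P D U Φ).HasInputStateIntegralTurnpike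
      (controllableSet ((J - R) * Q) (B - P) U {xe})
      (LinearMap.ker (Matrix.toEuclideanLin (dissipationMatrix R Q P D))) := by
  have hQt : Qᵀ = Q := by
    rw [← Matrix.conjTranspose_eq_transpose_of_trivial]
    exact hQ.1
  have hUb := hUcomp.isBounded
  have hueU := interior_subset hue
  have hs := hopt.steady.eq
  obtain ⟨z, hz, t2, ht2, hxe⟩ := mem_controllableSet_iff.1 hreach
  refine ⟨?_, ?_⟩
  · intro x0 hx0
    obtain ⟨w, hw, t1, ht1, hx0t⟩ := mem_controllableSet_iff.1 hx0
    obtain rfl : w = xe := hw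
    exact mem_controllableSet_iff.2 ⟨z, hz, t1 + t2, by positivity,
      controllableSetAt_trans ht1 ht2 hx0t hxe⟩
  obtain ⟨x2, u2, hu2, hx2, hx2z⟩ := hxe
  obtain ⟨τ, hτc, hτ⟩ := exists_continuous_mem_controllableSetAt hUb hue hs
  obtain ⟨β, hβc, hβ⟩ := exists_integral_supplyRate_le ((J - R) * Q) (B - P) Q B P D hUb
  obtain ⟨K, hK, hKW⟩ := hW.exists_sq_infDist_ker_le
  have hQc := LinearMap.continuous_of_finiteDimensional Q.toEuclideanLin
  have hse : supplyRate Q B P D xe ue ≤ 0 := by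
    have := hopt.optimal 0 0 ⟨interior_subset hU0, by simp⟩
    simpa [supplyRate] using this
  -- Initial energy plus the costs of the two moving phases of the competitor, scaled by the
  -- distance constant `K`; the resting phase contributes nothing positive.
  let F : controllableSet ((J - R) * Q) (B - P) U {xe} → ℝ := fun x0 =>
    K * ((1 / 2) * inner ℝ (Q.toEuclideanLin x0) (x0 : EuclideanSpace ℝ (Fin n)) +
      β (τ x0) x0 + β t2 xe)
  have hFc : Continuous F := by
    have h1 : Continuous fun x0 : controllableSet ((J - R) * Q) (B - P) U {xe} =>
        β (τ x0) x0 := hβc.comp (hτc.prodMk continuous_subtype_val)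
    have h2 : Continuous fun x0 : controllableSet ((J - R) * Q) (B - P) U {xe} =>
        inner ℝ (Q.toEuclideanLin x0) (x0 : EuclideanSpace ℝ (Fin n)) :=
      (hQc.comp continuous_subtype_val).inner continuous_subtype_val
    exact continuous_const.mul (((continuous_const.mul h2).add h1).add continuous_const)
  refine ⟨fun x0 => (F x0).toNNReal, fun x0 => (τ x0 + t2).toNNReal,
    continuous_real_toNNReal.comp hFc,
    continuous_real_toNNReal.comp (hτc.add continuous_const), ?_⟩
  intro x0 T hT x u hxu
  obtain ⟨hτ0, x1, u1, hu1, hx1, hx1e⟩ := hτ x0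
  rw [Real.coe_toNNReal _ (by positivity)] at hT
  have hT0 : 0 ≤ T := by linarith
  have hu : IsControl U T u := hxu.admissible.control
  have hx : IsTrajectory ((J - R) * Q) (B - P) T x0 x u := hxu.admissible.trajectory
  have idist := hu.intervalIntegrable_comp hT0 hUb hx.cont
    (g := fun a b => Metric.infDist (stack a b)
      (LinearMap.ker (Matrix.toEuclideanLin (dissipationMatrix R Q P D))) ^ 2)
    (continuous_sq_infDist_stack _)
  have iW := hu.intervalIntegrable_comp hT0 hUb hx.cont
    (g := fun a b => inner ℝ (stack a b) ((dissipationMatrix R Q P D).toEuclideanLin (stack a b)))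
    (continuous_dissipation (dissipationMatrix R Q P D))
  refine ⟨idist, le_trans ?_ (Real.le_coe_toNNReal _)⟩
  have hle : ∫ t in (0 : ℝ)..T, Metric.infDist (stack (x t) (u t))
      (LinearMap.ker (Matrix.toEuclideanLin (dissipationMatrix R Q P D))) ^ 2 ≤
      K * ∫ t in (0 : ℝ)..T, inner ℝ (stack (x t) (u t))
        ((dissipationMatrix R Q P D).toEuclideanLin (stack (x t) (u t))) := by
    rw [← intervalIntegral.integral_const_mul]
    exact intervalIntegral.integral_mono_on hT0 idist (iW.const_mul K) fun t _ => hKW _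
  refine hle.trans (mul_le_mul_of_nonneg_left ?_ hK)
  have hbal := integral_supplyRate_eq (D := D) hJ hQt hT0 hUb hu hx
  -- The terminal energy enters the balance with a favourable sign and is dropped.
  have hpos : 0 ≤ inner ℝ (Q.toEuclideanLin (x T)) (x T) := by
    rw [real_inner_comm, EuclideanSpace.inner_eq_star_dotProduct, dotProduct_comm]
    exact hQ.dotProduct_mulVec_nonneg _
  -- The resting time fills the horizon exactly; it is nonnegative since `T` exceeds `τ x0 + t2`.
  set tr := T - τ x0 - t2 with htr
  have htr0 : 0 ≤ tr := by linarith
  have hrest : IsControl U tr (fun _ => ue) := isControl_const hueU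
  have hrest' : IsTrajectory ((J - R) * Q) (B - P) tr xe (fun _ => xe) (fun _ => ue) :=
    isTrajectory_const hs
  have hutail := hrest.glue htr0 ht2 hu2
  have hxtail := hrest'.glue htr0 ht2 hrest hx2 hu2
  have hx20 := hx2.apply_zero ht2
  have htail0 : glue tr (fun _ => xe) x2 0 = x1 (τ x0) := by
    rw [glue_of_le _ _ htr0, hx1e]
  have hsum : τ x0 + (tr + t2) = T := by ring
  have hcu := hu1.glue hτ0 (by positivity) hutail
  have hcx := hx1.glue hτ0 (by positivity) hu1 (by rwa [hx1e]) hutail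
  have hend : glue (τ x0) x1 (glue tr (fun _ => xe) x2) (τ x0 + (tr + t2)) = z := by
    rw [glue_add_of_eq (by positivity) htail0, glue_add_of_eq ht2 hx20, hx2z]
  have j1 := hu1.intervalIntegrable_comp hτ0 hUb hx1.cont (continuous_supplyRate Q B P D)
  have j2 := hrest.intervalIntegrable_comp htr0 hUb hrest'.cont (continuous_supplyRate Q B P D)
  have j3 := hu2.intervalIntegrable_comp ht2 hUb hx2.cont (continuous_supplyRate Q B P D)
  have hcost : ∫ t in (0 : ℝ)..τ x0 + (tr + t2),
      supplyRate Q B P D (glue (τ x0) x1 (glue tr (fun _ => xe) x2) t)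
        (glue (τ x0) u1 (glue tr (fun _ => ue) u2) t) ≤ β (τ x0) x0 + β t2 xe := by
    have e1 := map_glue (supplyRate Q B P D) tr (fun _ => xe) x2 (fun _ => ue) u2
    rw [map_glue, e1, integral_glue hτ0 (by positivity) j1 (intervalIntegrable_glue htr0 ht2 j2 j3),
      integral_glue htr0 ht2 j2 j3]
    have b1 := hβ _ _ _ _ hτ0 hu1 hx1
    have b3 := hβ _ _ _ _ ht2 hu2 hx2
    have b2 : ∫ _ in (0 : ℝ)..tr, supplyRate Q B P D xe ue ≤ 0 := by
      rw [intervalIntegral.integral_const, smul_eq_mul, sub_zero]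
      exact mul_nonpos_of_nonneg_of_nonpos htr0 hse
    linarith
  rw [hsum] at hcu hcx hend hcost
  have hopt' := hxu.optimal _ _ ⟨hcu, hcx, by rw [hend]; exact hz⟩
  simp only [LinearOCP.cost, phOCP, zero_add] at hopt'
  linarith
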